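/- Let $k$ and $l$ be positive integers with $l<k$ and $\gcd(l,k)=1$, and let $l'\in\{1,\dots,k-1\}$ be the inverse of $l$ modulo $k$. Let $\mathrm{Tr}_k(x)=\sum_{i=0}^{k-1}x^{2^i}$ be the absolute trace on $\mathrm{GF}(2^k)$, let $e(i)=1+2^l+2^{2l}+\cdots+2^{(i-1)l}$ for $i\ge 1$, and define polynomials over $\mathrm{GF}(2^k)$ by \[A_1=x,\quad A_2=x^{2^l+1},\quad A_{i+2}=x^{2^{(i+1)l}}A_{i+1}+x^{2^{(i+1)l}-2^{il}}A_i\quad(i\ge1),\] \[B_1=0,\quad B_2=x^{2^l-1},\quad B_{i+2}=x^{2^{(i+1)l}}B_{i+1}+x^{2^{(i+1)l}-2^{il}}B_i\quad(i\ge1),\] \[R(x)=\sum_{i=1}^{l'}A_i(x)+B_{l'}(x)\quad\text{(Dobbertin's polynomial)},\qquad H_{i}(x)=x\sum_{j=1}^{i}(1+x)^{e(j)-1}\quad(i\ge1).\] For $a\in\mathrm{GF}(2^k)^*=\mathrm{GF}(2^k)\setminus\{0\}$ let $P_a(x)=x^{2^l+1}+x+a$, and let $M_i$ be the number of $a\in\mathrm{GF}(2^k)^*$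 such that $P_a$ has exactly $i$ zeros in $\mathrm{GF}(2^k)$. Then, for every $a\in\mathrm{GF}(2^k)^*$, the polynomial $P_a$ has either none, one, or three zeros in $\mathrm{GF}(2^k)$. It has exactly one zero in $\mathrm{GF}(2^k)$ if and only if $\mathrm{Tr}_k(R(a^{-1})+1)=1$. Moreover, if $P_a(x_0)=0$ for some $x_0\in\mathrm{GF}(2^k)$, then \[\mathrm{Tr}_k(R(a^{-1}))=\mathrm{Tr}_k(H_{l'}(x_0^{-1}))=\mathrm{Tr}_k\big((1+x_0^{-1})^{e(l')}+1\big).\] Finally, if $k$ is odd, then \[M_0=\frac{2^k+1}{3},\qquad M_1=2^{k-1}-1,\qquad M_3=\frac{2^{k-1}-1}{3},\] and if $k$ is even, then \[M_0=\frac{2^k-1}{3},\qquad M_1=2^{k-1},\qquad M_3=\frac{2^{k-1}-2}{3}.\] -/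

import Mathlib

open Polynomial

namespace TrinomialGF

noncomputable section

/-- The absolute trace `x + x^2 + x^4 + ... + x^(2^(k-1))` of the field with `2^k` elements. -/
def absTrace {K : Type*} [Field K] (k : ℕ) (x : K) : K :=
  ∑ i ∈ Finset.range k, x ^ (2 ^ i)

/-- The polynomial `P_a(x) = x^(2^l+1) + x + a`. -/
def P {K : Type*} [Field K] (l : ℕ) (a : K) : K[X] :=
  X ^ (2 ^ l + 1) + X + C a

/-- The number of distinct zeros of `P_a` in `K`. -/
def numZeros {K : Type*} [Field K] (l : ℕ) (a : K) : ℕ :=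
  {x : K | (P l a).eval x = 0}.ncard

/-- `M_i`, the number of nonzero `a` in `K` such that `P_a` has exactly `i` zeros in `K`. -/
def M (K : Type*) [Field K] (l i : ℕ) : ℕ :=
  {a : K | a ≠ 0 ∧ numZeros l a = i}.ncard

/-- Dobbertin's sequence `A_1, A_2, ...` (the value at index `0` is a dummy). -/
def A (K : Type*) [Field K] (l : ℕ) : ℕ → K[X]
  | 0 => 0
  | 1 => X
  | 2 => X ^ (2 ^ l + 1)
  | i + 3 =>
      X ^ (2 ^ ((i + 2) * l)) * A K l (i + 2) +
        X ^ (2 ^ ((i + 2) * l) - 2 ^ ((i + 1) * l)) * A K l (i + 1)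

/-- Dobbertin's sequence `B_1, B_2, ...` (the value at index `0` is a dummy). -/
def B (K : Type*) [Field K] (l : ℕ) : ℕ → K[X]
  | 0 => 0
  | 1 => 0
  | 2 => X ^ (2 ^ l - 1)
  | i + 3 =>
      X ^ (2 ^ ((i + 2) * l)) * B K l (i + 2) +
        X ^ (2 ^ ((i + 2) * l) - 2 ^ ((i + 1) * l)) * B K l (i + 1)

/-- Dobbertin's polynomial `R = A_1 + ... + A_{l'} + B_{l'}`. -/
def R (K : Type*) [Field K] (l l' : ℕ) : K[X] :=
  (∑ i ∈ Finset.Icc 1 l', A K l i) + B K l l'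

/-- The exponent `e(i) = 1 + 2^l + 2^(2l) + ... + 2^((i-1)l)`. -/
def e (l i : ℕ) : ℕ := ∑ j ∈ Finset.range i, 2 ^ (j * l)

/-- The polynomial
`H_i(x) = x (1 + (1+x)^(2^l) + (1+x)^(2^l+2^(2l)) + ... + (1+x)^(e(i)-1))`;
the exponents in the bracket are `e(j) - 1` for `j = 1, ..., i`. -/
def H (K : Type*) [Field K] (l i : ℕ) : K[X] :=
  X * ∑ j ∈ Finset.Icc 1 i, (1 + X) ^ (e l j - 1)

end

end TrinomialGF

namespace TrinomialGF

/-! ### Semilinear algebra over `σ`: the equation solved by Dobbertin's polynomial -/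

section Semilinear

variable {K : Type*} [Field K] (σ : K →+* K) {n : ℕ}

/-! Put `σ x = x^(2^l)`, so that `P_a(x) = x σ(x) + x + a`. With `n = l'`, `σ^[n]` is squaring, so
`σ` fixes only `0` and `1`.

Zeros: for `a ≠ 0` a zero `x` is `s / (σ s + s)` with `s = (1 + x⁻¹)^(e n)` (`exists_zeroOf_eq`).
Inverting the difference of two zeros linearizes the equation: further zeros correspond to solutions
of `σ t + t = σ s`. There are none if `Tr s = 1` and two, `t` and `t + 1`, if `Tr s = 0`.

Trace criterion: `z = R(a⁻¹)` solves `L_a(z) = σ(a) σ²(z) + σ(z) + a z = 1` (`semilin_dobbertin`).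
If `P_a` has a zero with parameter `s`, every solution has trace `Tr (1 + s)` (`trace_of_semilin`).
If `P_a` has no zero, `Tr z = Tr 1` follows from an injection of a finite set into itself
(`trace_of_semilin_of_no_zero`).

Counts: `M_1` is the number of `s ≠ 1` of trace one; counting all `a ≠ 0`, and all `x ≠ 0, 1`
according to the `a` they are zeros for, gives `M_0` and `M_3`. -/

theorem eq_zero_or_one_of_fixed (hn : ∀ x, σ^[n] x = x ^ 2) {x : K} (hx : σ x = x) :
    x = 0 ∨ x = 1 := by
  have h := hn x
  rw [Function.iterate_fixed hx] at h
  have : x * (x - 1) = 0 := by linear_combination -h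
  rcases mul_eq_zero.1 this with h | h
  · exact Or.inl h
  · exact Or.inr (sub_eq_zero.1 h)

variable [CharP K 2]

theorem map_add_self_ne_zero (hn : ∀ x, σ^[n] x = x ^ 2) {s : K} (h0 : s ≠ 0) (h1 : s ≠ 1) :
    σ s + s ≠ 0 := fun h =>
  (eq_zero_or_one_of_fixed σ hn (CharTwo.add_eq_zero.1 h)).elim h0 h1

/-- The partial trace `σ x + σ² x + ⋯ + σⁿ x`. -/
def partialTrace (n : ℕ) (x : K) : K := ∑ i ∈ Finset.range n, σ^[i + 1] x

theorem map_partialTrace_add_self (hn : ∀ x, σ^[n] x = x ^ 2) (x : K) :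
    σ (partialTrace σ n x) + partialTrace σ n x = σ x ^ 2 + σ x := by
  have h1 : σ (partialTrace σ n x) = ∑ i ∈ Finset.range n, σ^[i + 2] x := by
    simp only [partialTrace, map_sum, ← Function.iterate_succ_apply' σ]
  have h2 := Finset.sum_range_succ (fun i => σ^[i + 1] x) n
  have h3 := Finset.sum_range_succ' (fun i => σ^[i + 1] x) n
  have h4 : σ^[n + 1] x = σ x ^ 2 := by rw [Function.iterate_succ_apply, hn]
  rw [h1, partialTrace]
  rw [h2, h4] at h3
  have h5 := CharTwo.two_eq_zero (R := K)
  simp only [zero_add, Function.iterate_one, add_assoc, Nat.reduceAdd] at h3 ⊢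
  grind

/-- The semilinear operator `z ↦ σ(a) σ²(z) + σ(z) + a z`. -/
def semilin (a z : K) : K := σ a * σ (σ z) + σ z + a * z

/-- A sequence satisfying the recurrence of `A_1, A_2, …` at a nonzero argument `a⁻¹` also satisfies
a recurrence built from the other end. -/
theorem mul_dobbertin_eq {a : K} (ha : a ≠ 0) {u : ℕ → K} (h0 : u 0 = 0) (h1 : u 1 = a⁻¹)
    (hu : ∀ i, σ^[i + 1] a * u (i + 2) = u (i + 1) + σ^[i] a * u i) (i : ℕ) :
    a * u (i + 2) = σ (u (i + 1)) + σ a * σ (σ (u i)) := by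
  have hne : ∀ i, σ^[i] a ≠ 0 := fun i => by
    induction i with
    | zero => simpa
    | succ i ih => rw [Function.iterate_succ_apply']; simpa
  have hs : ∀ i, σ (σ^[i] a) = σ^[i + 1] a := fun i => (Function.iterate_succ_apply' σ i a).symm
  induction i using Nat.twoStepInduction with
  | zero =>
    have := hu 0
    have hσ : σ a ≠ 0 := by simpa
    simp only [h0, h1, zero_add, Function.iterate_one, mul_zero, add_zero, map_zero, map_inv₀] at this ⊢
    field_simp at this ⊢
    linear_combination this
  | one =>
    have e0 := hu 0
    have e1 := hu 1
    have hσ : σ a ≠ 0 := by simpa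
    have f0 := congrArg σ e0
    have hσσ : σ (σ a) ≠ 0 := by simpa
    simp only [h0, h1, zero_add, Function.iterate_succ_apply, Function.iterate_zero_apply, mul_zero,
      add_zero, map_inv₀, map_mul, Nat.reduceAdd] at e0 e1 f0 ⊢
    field_simp at e0 e1 f0 ⊢
    apply mul_left_cancel₀ hσσ
    grind
  | more i ih1 ih2 =>
    apply mul_left_cancel₀ (hne (i + 3))
    have e := hu (i + 2)
    have e1 := congrArg σ (hu (i + 1))
    have e2 := congrArg σ (congrArg σ (hu i))
    simp only [map_mul, map_add, hs] at e e1 e2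
    simp only [add_assoc, Nat.reduceAdd] at *
    grind

/-- By the recurrence from the other end, applying `L_a` to `∑ u i` telescopes to `1` plus boundary
terms. The term `v (n + 1)` cancels them, because `σ^[n + 1]` is squaring. -/
theorem semilin_dobbertin {a : K} (ha : a ≠ 0) (hn : ∀ x, σ^[n + 1] x = x ^ 2)
    {u v : ℕ → K} (h0 : u 0 = 0) (h1 : u 1 = a⁻¹)
    (hu : ∀ i, σ^[i + 1] a * u (i + 2) = u (i + 1) + σ^[i] a * u i)
    (v1 : v 1 = 0) (v2 : σ a * v 2 = a)
    (hv : ∀ i, σ^[i + 2] a * v (i + 3) = v (i + 2) + σ^[i + 1] a * v (i + 1)) :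
    semilin σ a ((∑ i ∈ Finset.Icc 1 (n + 1), u i) + v (n + 1)) = 1 := by
  have hne : ∀ i, σ^[i] a ≠ 0 := fun i => by
    induction i with
    | zero => simpa
    | succ i ih => rw [Function.iterate_succ_apply']; simpa
  have hs : ∀ i, σ (σ^[i] a) = σ^[i + 1] a := fun i => (Function.iterate_succ_apply' σ i a).symm
  have two := CharTwo.two_eq_zero (R := K)
  have left := mul_dobbertin_eq σ ha h0 h1 hu
  -- Both sides satisfy the same recurrence with the same initial values.
  have hvu : ∀ i, v (i + 1) = a * σ (u i) := fun i => by
    induction i using Nat.twoStepInduction with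
    | zero => simp [v1, h0]
    | one =>
      have hσ : σ a ≠ 0 := by simpa
      rw [h1, map_inv₀, ← div_eq_mul_inv, eq_div_iff hσ, mul_comm, v2]
    | more i ih1 ih2 =>
      apply mul_left_cancel₀ (hne (i + 2))
      have e := congrArg σ (hu i)
      simp only [map_mul, map_add, hs] at e
      have e' := hv i
      simp only [add_assoc, Nat.reduceAdd] at *
      grind
  have hsum : ∀ n, semilin σ a (∑ i ∈ Finset.Icc 1 (n + 1), u i) =
      1 + σ (u (n + 1)) + σ a * σ (σ (u (n + 1) + u n)) := fun n => by
    induction n with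
    | zero =>
      simp only [semilin, zero_add, Finset.Icc_self, Finset.sum_singleton, h0, add_zero]
      rw [h1, mul_inv_cancel₀ ha]
      ring
    | succ n ih =>
      rw [Finset.sum_Icc_succ_top (by omega)]
      have := left n
      simp only [semilin, map_add] at ih ⊢
      grind
  have hL : ∀ x y, semilin σ a (x + y) = semilin σ a x + semilin σ a y := fun x y => by
    simp only [semilin, map_add]; ring
  rw [hL, hsum, hvu]
  have e1 := congrArg σ (left n)
  have e2 := congrArg σ (hu n)
  simp only [map_mul, map_add, hs] at e1 e2
  rw [hn] at e2
  rw [show σ^[n + 1 + 1] a = σ a ^ 2 by rw [Function.iterate_succ_apply, hn]] at e2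
  simp only [semilin, map_add, map_mul]
  grind

end Semilinear

/-! ### Zeros of `x σ(x) + x + a` when one is known -/

section Zeros

variable {K : Type*} [Field K] (σ : K →+* K) {n : ℕ}

/-- The zero `s / (σ s + s)` attached to `s`. -/
def zeroOf (s : K) : K := s / (σ s + s)

/-- The constant term of the trinomial that vanishes at `zeroOf σ s`. -/
def coeffOf (s : K) : K := zeroOf σ s * σ (zeroOf σ s) + zeroOf σ s

variable [CharP K 2]

theorem eq_coeffOf_of_zero {a s : K} (h : zeroOf σ s * σ (zeroOf σ s) + zeroOf σ s + a = 0) :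
    a = coeffOf σ s := (CharTwo.add_eq_zero.1 h).symm

theorem coeffOf_eq {s : K} (hD : σ s + s ≠ 0) :
    coeffOf σ s = s * σ (σ s) / ((σ s + s) * (σ (σ s) + σ s)) := by
  have hσD : σ (σ s) + σ s ≠ 0 := by rw [← map_add]; exact (map_ne_zero σ).2 hD
  have two := CharTwo.two_eq_zero (R := K)
  simp only [coeffOf, zeroOf, map_div₀, map_add]
  field_simp
  grind

theorem coeffOf_ne_zero {s : K} (h0 : s ≠ 0) (hD : σ s + s ≠ 0) : coeffOf σ s ≠ 0 := by
  have hσD : σ (σ s) + σ s ≠ 0 := by rw [← map_add]; exact (map_ne_zero σ).2 hD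
  rw [coeffOf_eq σ hD]
  have : σ (σ s) ≠ 0 := by simpa
  exact div_ne_zero (mul_ne_zero h0 this) (mul_ne_zero hD hσD)

/-- The difference `y = x + x₀` satisfies `y σ(y) + x₀ σ(y) + (σ(x₀) + 1) y = 0`; dividing by `y
σ(y)` leaves a linear equation in `y⁻¹`, which `t = x₀ σ(s) / y` normalizes. -/
theorem exists_of_zero {s a x : K} (h0 : s ≠ 0) (hD : σ s + s ≠ 0)
    (ha : a = coeffOf σ s) (hx : x * σ x + x + a = 0) (hne : x ≠ zeroOf σ s) :
    ∃ t, σ t + t = σ s ∧ x = s * σ t / ((σ s + s) * t) := by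
  have two := CharTwo.two_eq_zero (R := K)
  set x₀ := zeroOf σ s with hx₀
  have hxx : x + x₀ ≠ 0 := fun h => hne (CharTwo.add_eq_zero.1 h)
  have hσxx : σ x + σ x₀ ≠ 0 := by rw [← map_add]; exact (map_ne_zero σ).2 hxx
  have hs : s = x₀ * (σ s + s) := by rw [hx₀, zeroOf]; field_simp
  have hσs0 : σ s ≠ 0 := by simpa
  have hσs := congrArg σ hs
  simp only [map_mul, map_add] at hσs
  rw [ha, coeffOf, ← hx₀] at hx
  have hx0 : x₀ ≠ 0 := fun h => h0 (by rw [hs, h, zero_mul])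
  have ht : σ (x₀ * σ s / (x + x₀)) + x₀ * σ s / (x + x₀) = σ s := by
    simp only [map_div₀, map_mul, map_add]
    field_simp
    have e1 : σ x₀ * σ (σ s) = σ s * (1 + σ x₀) := by grind
    rw [e1]
    grind
  refine ⟨_, ht, ?_⟩
  rw [mul_div_mul_comm, CharTwo.add_eq_iff_eq_add.1 ht, ← zeroOf, ← hx₀, add_div, div_self (by positivity)]
  field_simp
  grind

theorem zero_of_eq {s t : K} (h0 : s ≠ 0) (hD : σ s + s ≠ 0) (ht : σ t + t = σ s) :
    t ≠ 0 ∧ s * σ t / ((σ s + s) * t) ≠ zeroOf σ s ∧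
      s * σ t / ((σ s + s) * t) * σ (s * σ t / ((σ s + s) * t)) +
        s * σ t / ((σ s + s) * t) + coeffOf σ s = 0 := by
  have two := CharTwo.two_eq_zero (R := K)
  have hσs0 : σ s ≠ 0 := by simpa
  have hσD : σ (σ s) + σ s ≠ 0 := by rw [← map_add]; exact (map_ne_zero σ).2 hD
  have t0 : t ≠ 0 := by
    rintro rfl
    simp at ht
    exact hσs0 ht.symm
  have hσt : σ t ≠ 0 := by simpa
  refine ⟨t0, fun h => ?_, ?_⟩
  · rw [zeroOf] at h
    field_simp at h
    apply hσs0
    rw [← ht, h, CharTwo.add_self_eq_zero]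
  · have ht2 := congrArg σ ht
    simp only [map_add] at ht2
    rw [coeffOf_eq σ hD]
    simp only [map_div₀, map_mul, map_add]
    field_simp
    have e1 : σ (σ t) = σ (σ s) + σ t := by grind
    have e2 : t = σ s + σ t := by grind
    rw [e1, e2]
    ring_nf
    grind

variable (T : K →+ K)

theorem zeros_eq_singleton (hT : ∀ x, T (σ x) = T x) {s a : K} (h0 : s ≠ 0) (hD : σ s + s ≠ 0)
    (ha : a = coeffOf σ s) (hs : T s ≠ 0) :
    {x : K | x * σ x + x + a = 0} = {zeroOf σ s} := by
  ext x
  simp only [Set.mem_ofPred_eq, Set.mem_singleton_iff]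
  constructor
  · intro hx
    by_contra hne
    obtain ⟨t, ht, -⟩ := exists_of_zero σ h0 hD ha hx hne
    apply hs
    rw [← hT, ← ht, map_add, hT, CharTwo.add_self_eq_zero]
  · rintro rfl
    rw [ha, coeffOf, CharTwo.add_self_eq_zero]

/-- If `s = h² + h`, the partial trace of `h` solves `σ t + t = σ s`; the only other solution is `t
+ 1`. -/
theorem ncard_zeros_eq_three (hn : ∀ x, σ^[n] x = x ^ 2)
    {s a : K} (h0 : s ≠ 0) (hD : σ s + s ≠ 0)
    (ha : a = coeffOf σ s) (hs : ∃ h, h ^ 2 + h = s) :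
    {x : K | x * σ x + x + a = 0}.ncard = 3 := by
  obtain ⟨h, hh⟩ := hs
  have hσs0 : σ s ≠ 0 := by simpa
  have two := CharTwo.two_eq_zero (R := K)
  have ht : σ (partialTrace σ n h) + partialTrace σ n h = σ s := by
    rw [map_partialTrace_add_self σ hn, ← hh]; simp
  generalize partialTrace σ n h = t at ht
  have ht' : σ (t + 1) + (t + 1) = σ s := by
    rw [← ht, map_add, map_one]; grind
  obtain ⟨t0, n0, z0⟩ := zero_of_eq σ h0 hD ht
  obtain ⟨t1, n1, z1⟩ := zero_of_eq σ h0 hD ht'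
  have n01 : s * σ t / ((σ s + s) * t) ≠ s * σ (t + 1) / ((σ s + s) * (t + 1)) := by
    intro h
    field_simp at h
    rw [map_add, map_one] at h
    apply hσs0
    grind
  rw [Set.ncard_eq_three]
  refine ⟨_, _, _, n0.symm, n1.symm, n01, ?_⟩
  ext x
  simp only [Set.mem_ofPred_eq, Set.mem_singleton_iff, Set.mem_insert_iff]
  constructor
  · intro hx
    by_contra! hne
    obtain ⟨hx0, hx1, hx2⟩ := hne
    obtain ⟨t', ht', rfl⟩ := exists_of_zero σ h0 hD ha hx hx0
    have hfix : σ (t' + t) = t' + t := by rw [map_add]; grind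
    rcases eq_zero_or_one_of_fixed σ hn hfix with h | h
    · exact hx1 (by rw [CharTwo.add_eq_zero.1 h])
    · exact hx2 (by rw [show t' = t + 1 by grind])
  · rintro (rfl | rfl | rfl)
    · rw [ha, coeffOf, CharTwo.add_self_eq_zero]
    · rw [ha]; exact z0
    · rw [ha]; exact z1

end Zeros

/-! ### Traces of the solutions of `L_a(z) = 1` -/

section Balance

variable {K : Type*} [Field K] (σ : K →+* K) {n : ℕ}

theorem zeroOf_injective (hn : ∀ x, σ^[n] x = x ^ 2) {s t : K}
    (hs : s ≠ 0) (ht : t ≠ 0) (hDs : σ s + s ≠ 0) (hDt : σ t + t ≠ 0)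
    (h : zeroOf σ s = zeroOf σ t) : s = t := by
  have hσt : σ t ≠ 0 := (map_ne_zero σ).2 ht
  have key : σ (s / t) = s / t := by
    rw [map_div₀, div_eq_div_iff hσt ht]
    rw [zeroOf, zeroOf, div_eq_div_iff hDs hDt] at h
    linear_combination -h
  rcases eq_zero_or_one_of_fixed σ hn key with h | h
  · exact absurd h (div_ne_zero hs ht)
  · exact (div_eq_one_iff_eq ht).1 h

variable [CharP K 2]

/-- Multiplying `L_a(z) = 1` by `σ z` shows that `σ` moves `a z σ(z)` by `σ(z)² + σ(z)`, exactly as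
it moves the partial trace. For given `z ≠ 0` this invariant, an element of `{0, 1}`, determines
`a`. -/
theorem map_invariant {a z : K} (hn : ∀ x, σ^[n] x = x ^ 2) (h : semilin σ a z = 1) :
    σ (a * z * σ z + partialTrace σ n z) = a * z * σ z + partialTrace σ n z := by
  have two := CharTwo.two_eq_zero (R := K)
  have e := map_partialTrace_add_self σ hn z
  simp only [semilin] at h
  simp only [map_add, map_mul]
  grind

/-- After `z = m (1/s + 1/σ s)`, it suffices that `σ m + m = σ(s)² + σ(s)`, which the partial trace
of `s` satisfies. -/
theorem semilin_solution {s η : K} (hn : ∀ x, σ^[n] x = x ^ 2) (h0 : s ≠ 0) (hD : σ s + s ≠ 0)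
    (hη : σ η = η) :
    semilin σ (coeffOf σ s) ((partialTrace σ n s + η) * ((σ s + s) / (s * σ s))) = 1 := by
  have two := CharTwo.two_eq_zero (R := K)
  have hσs0 : σ s ≠ 0 := (map_ne_zero σ).2 h0
  have hσσs0 : σ (σ s) ≠ 0 := (map_ne_zero σ).2 hσs0
  have hσσσs0 : σ (σ (σ s)) ≠ 0 := (map_ne_zero σ).2 hσσs0
  have hσD : σ (σ s) + σ s ≠ 0 := by rw [← map_add]; exact (map_ne_zero σ).2 hD
  have hσσD : σ (σ (σ s)) + σ (σ s) ≠ 0 := by rw [← map_add]; exact (map_ne_zero σ).2 hσD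
  have e := map_partialTrace_add_self σ hn s
  generalize partialTrace σ n s = m at e
  rw [coeffOf_eq σ hD]
  have e1 : σ m = m + σ s ^ 2 + σ s := by grind
  simp only [semilin, map_add, map_mul, map_div₀, map_pow, hη, e1]
  field_simp
  clear e e1 hn hη h0 hD hσs0 hσσs0 hσσσs0 hσD hσσD
  grind

theorem trace_of_semilin (T : K →+ K) (hT : ∀ x, T (σ x) = T x) (hn : ∀ x, σ^[n] x = x ^ 2)
    {s z : K} (h0 : s ≠ 0) (hD : σ s + s ≠ 0)
    (h : semilin σ (coeffOf σ s) z = 1) : T z = T (1 + s) := by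
  have two := CharTwo.two_eq_zero (R := K)
  have hσs0 : σ s ≠ 0 := (map_ne_zero σ).2 h0
  have hσσs0 : σ (σ s) ≠ 0 := (map_ne_zero σ).2 hσs0
  have hσσσs0 : σ (σ (σ s)) ≠ 0 := (map_ne_zero σ).2 hσσs0
  have hσD : σ (σ s) + σ s ≠ 0 := by rw [← map_add]; exact (map_ne_zero σ).2 hD
  have hσσD : σ (σ (σ s)) + σ (σ s) ≠ 0 := by rw [← map_add]; exact (map_ne_zero σ).2 hσD
  obtain ⟨m, rfl⟩ : ∃ m, z = m * ((σ s + s) / (s * σ s)) :=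
    ⟨z / ((σ s + s) / (s * σ s)), by field_simp⟩
  rw [coeffOf_eq σ hD] at h
  simp only [semilin, map_add, map_mul, map_div₀] at h
  field_simp at h
  -- The equation for `m` says that this quotient `d` is `σ`-fixed, hence `0` or `1`. Then `Tr z =
  -- Tr (1 + d σ s)`, while `Tr (σ m + m) = 0` forces `Tr s = 0` when `d = 0`.
  have hd : σ ((σ m + m + σ s) / σ s ^ 2) = (σ m + m + σ s) / σ s ^ 2 := by
    simp only [map_add, map_div₀, map_pow]
    field_simp
    grind
  obtain ⟨d, hd01, hm⟩ : ∃ d : K, (d = 0 ∨ d = 1) ∧ σ m + m = σ s + d * σ (s ^ 2) := by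
    refine ⟨_, eq_zero_or_one_of_fixed σ hn hd, ?_⟩
    rw [map_pow, div_mul_cancel₀ _ (pow_ne_zero 2 hσs0)]
    grind
  have hsq : ∀ x, T (x ^ 2) = T x := fun x => by
    rw [← hn]
    generalize n = n
    induction n with
    | zero => rfl
    | succ n ih => rw [Function.iterate_succ_apply', hT, ih]
  have hTm : T (σ m + m) = 0 := by rw [map_add, hT, CharTwo.add_self_eq_zero]
  have e1 : T (m * ((σ s + s) / (s * σ s))) = T (1 + d * σ s) := by
    have : m * ((σ s + s) / (s * σ s)) = m / s + m / σ s := by field_simp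
    rw [this, map_add, ← hT (m / s), map_div₀, ← map_add, ← add_div, hm, map_pow]
    congr 1
    field_simp
  rw [e1, map_add, map_add]
  congr 1
  rw [hm, map_add, hT] at hTm
  rcases hd01 with rfl | rfl
  · simpa using hTm.symm
  · simp [hT]

/-- If `x σ(x) + x + a` has no zero, every solution of `L_a(z) = 1` has the trace of `1`. -/
theorem trace_of_semilin_of_no_zero [Finite K] (T : K →+ K) (hT : ∀ x, T (σ x) = T x)
    (hT01 : ∀ x, T x = 0 ∨ T x = 1)
    (hn : ∀ x, σ^[n] x = x ^ 2) {a z : K} (h : semilin σ a z = 1)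
    (hno : ∀ x, x * σ x + x + a ≠ 0) : T z = T 1 := by
  have two := CharTwo.two_eq_zero (R := K)
  by_contra hne
  have hz1 : T (z + 1) = 1 := by
    rw [map_add]
    rcases hT01 z with h | h <;> rcases hT01 1 with h' | h' <;> simp_all
  have hz0 : ∀ {a z : K}, semilin σ a z = 1 → z ≠ 0 := by
    rintro a z h rfl
    simp [semilin] at h
  let S := {s : K // T s = 1 ∧ s ≠ 1}
  let E := {η : K // σ η = η}
  have hS0 : ∀ s : S, s.1 ≠ 0 := fun s h0 => by
    have := s.2.1
    rw [h0, map_zero] at this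
    exact zero_ne_one this
  have hSD : ∀ s : S, σ s.1 + s.1 ≠ 0 := fun s => map_add_self_ne_zero σ hn (hS0 s) s.2.2
  have hS1 : ∀ s : S, T s.1 ≠ 0 := fun s => by rw [s.2.1]; exact one_ne_zero
  let sol : S × E → K := fun p =>
    (partialTrace σ n p.1.1 + p.2.1) * ((σ p.1.1 + p.1.1) / (p.1.1 * σ p.1.1))
  have hsol : ∀ p, semilin σ (coeffOf σ p.1.1) (sol p) = 1 := fun p =>
    semilin_solution σ hn (hS0 p.1) (hSD p.1) p.2.2
  have hsolT : ∀ p, T (sol p + 1) = 1 := fun p => by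
    rw [map_add, trace_of_semilin σ T hT hn (hS0 p.1) (hSD p.1) (hsol p), map_add, p.1.2.1]
    grind
  -- Injective: the image gives `z` and the invariant, hence `a`; as `Tr s = 1`, the zero of `P_a`
  -- is unique and gives `s`, and then `η`.
  let F : S × E → S × E := fun p =>
    (⟨sol p + 1, hsolT p, fun h => hz0 (hsol p) (by simpa using h)⟩,
      ⟨_, map_invariant σ hn (hsol p)⟩)
  have hdet : ∀ {a b z : K}, z ≠ 0 →
      a * z * σ z + partialTrace σ n z = b * z * σ z + partialTrace σ n z → a = b := by
    intro a b z hz hab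
    have hσz : σ z ≠ 0 := (map_ne_zero σ).2 hz
    exact mul_right_cancel₀ hz (mul_right_cancel₀ hσz (add_right_cancel hab))
  have hF : Function.Injective F := by
    intro p q hpq
    have e1 : sol p = sol q := by
      have := congrArg (fun r => r.1.1) hpq
      exact add_right_cancel this
    have e2 : coeffOf σ p.1.1 = coeffOf σ q.1.1 := by
      have := congrArg (fun r => r.2.1) hpq
      simp only [F] at this
      rw [e1] at this
      exact hdet (hz0 (hsol q)) this
    have e3 : p.1 = q.1 := by
      apply Subtype.ext
      apply zeroOf_injective σ hn (hS0 _) (hS0 _) (hSD _) (hSD _)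
      have z1 := zeros_eq_singleton σ T hT (hS0 p.1) (hSD p.1) rfl (hS1 p.1)
      have z2 := zeros_eq_singleton σ T hT (hS0 q.1) (hSD q.1) rfl (hS1 q.1)
      rw [e2, z2] at z1
      exact (Set.singleton_injective z1).symm
    refine Prod.ext e3 (Subtype.ext ?_)
    simp only [sol, e3] at e1
    have hne : (σ q.1.1 + q.1.1) / (q.1.1 * σ q.1.1) ≠ 0 :=
      div_ne_zero (hSD _) (mul_ne_zero (hS0 _) ((map_ne_zero σ).2 (hS0 _)))
    exact add_left_cancel (mul_right_cancel₀ hne e1)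
  -- Surjectivity puts the pair built from `z` in the image, so `a = coeffOf σ s` for some `s` and
  -- `P_a` has a zero after all.
  obtain ⟨p, hp⟩ := Finite.surjective_of_injective hF
    (⟨z + 1, hz1, fun h' => hz0 h (by simpa using h')⟩, ⟨_, map_invariant σ hn h⟩)
  have e1 : sol p = z := add_right_cancel (congrArg (fun r => r.1.1) hp)
  have e2 : coeffOf σ p.1.1 = a := by
    have := congrArg (fun r => r.2.1) hp
    simp only [F] at this
    rw [e1] at this
    exact hdet (hz0 h) this
  apply hno (zeroOf σ p.1.1)
  rw [← e2, coeffOf, CharTwo.add_self_eq_zero]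

end Balance

/-! ### The absolute trace -/

section Trace

variable {K : Type*} [Field K] {k : ℕ}

theorem charP_two_of_card [Finite K] (hK : Nat.card K = 2 ^ k) : CharP K 2 := by
  have : Fintype K := Fintype.ofFinite K
  apply CharTwo.of_one_ne_zero_of_two_eq_zero one_ne_zero
  have h : ((Fintype.card K : ℕ) : K) = 0 := Nat.cast_card_eq_zero K
  rw [← Nat.card_eq_fintype_card, hK, Nat.cast_pow] at h
  exact_mod_cast eq_zero_of_pow_eq_zero h

theorem pow_two_pow_eq_self [Finite K] (hK : Nat.card K = 2 ^ k) (x : K) : x ^ 2 ^ k = x := by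
  have : Fintype K := Fintype.ofFinite K
  rw [← hK, Nat.card_eq_fintype_card, FiniteField.pow_card]

theorem pow_two_pow_mul_eq_self [Finite K] (hK : Nat.card K = 2 ^ k) (x : K) (j : ℕ) :
    x ^ 2 ^ (k * j) = x := by
  induction j with
  | zero => simp
  | succ j ih => rw [Nat.mul_succ, pow_add, pow_mul, ih, pow_two_pow_eq_self hK]

variable [CharP K 2]

/-- The absolute trace as an additive map. -/
def absTraceHom (K : Type*) [Field K] [CharP K 2] (k : ℕ) : K →+ K where
  toFun := absTrace k
  map_zero' := by simp [absTrace]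
  map_add' x y := by simp only [absTrace, add_pow_char_pow, Finset.sum_add_distrib]

theorem absTraceHom_apply (x : K) : absTraceHom K k x = absTrace k x := rfl

theorem absTraceHom_one : absTraceHom K k 1 = k := by simp [absTraceHom_apply, absTrace]

theorem absTraceHom_pow_two [Finite K] (hK : Nat.card K = 2 ^ k) (x : K) :
    absTraceHom K k (x ^ 2) = absTraceHom K k x := by
  simp only [absTraceHom_apply, absTrace, ← pow_mul, ← pow_succ']
  have h1 := Finset.sum_range_succ (fun i => x ^ 2 ^ i) k
  rw [Finset.sum_range_succ'] at h1
  simpa [pow_two_pow_eq_self hK] using h1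

theorem absTraceHom_pow_two_pow [Finite K] (hK : Nat.card K = 2 ^ k) (x : K) (l : ℕ) :
    absTraceHom K k (x ^ 2 ^ l) = absTraceHom K k x := by
  induction l with
  | zero => simp
  | succ l ih => rw [pow_succ, pow_mul, absTraceHom_pow_two hK, ih]

theorem absTraceHom_eq_zero_or_one [Finite K] (hK : Nat.card K = 2 ^ k) (x : K) :
    absTraceHom K k x = 0 ∨ absTraceHom K k x = 1 := by
  have h : absTraceHom K k x ^ 2 = absTraceHom K k x := by
    conv_rhs => rw [← absTraceHom_pow_two hK x]
    simp only [absTraceHom_apply, absTrace, CharTwo.sum_sq, ← pow_mul, mul_comm]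
  have : absTraceHom K k x * (absTraceHom K k x - 1) = 0 := by linear_combination h
  rcases mul_eq_zero.1 this with h | h
  · exact Or.inl h
  · exact Or.inr (sub_eq_zero.1 h)

omit [CharP K 2] in
theorem ncard_absTrace_eq_zero_le (hk : 0 < k) : {x : K | absTrace k x = 0}.ncard ≤ 2 ^ (k - 1) := by
  classical
  let p : K[X] := ∑ i ∈ Finset.range k, X ^ 2 ^ i
  have hc : p.coeff (2 ^ (k - 1)) = 1 := by
    simp only [p, finsetSum_coeff, coeff_X_pow]
    rw [Finset.sum_eq_single (k - 1)]
    · simp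
    · intro b _ hb
      rw [if_neg]
      intro h
      exact hb (Nat.pow_right_injective le_rfl h).symm
    · simp [hk]
  have hp : p ≠ 0 := fun h => by simp [h] at hc
  have hd : p.natDegree ≤ 2 ^ (k - 1) := by
    apply natDegree_sum_le_of_forall_le
    intro i hi
    rw [natDegree_X_pow]
    exact Nat.pow_le_pow_right (by norm_num) (by have := Finset.mem_range.1 hi; omega)
  have hset : {x : K | absTrace k x = 0} = (p.roots.toFinset : Set K) := by
    ext x
    simp [hp, IsRoot, p, eval_finsetSum, absTrace]
  rw [hset, Set.ncard_coe_finset]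
  exact (Multiset.toFinset_card_le _).trans ((card_roots' p).trans hd)

/-- The additive map `x ↦ x² + x`. -/
def artinSchreier (K : Type*) [Field K] [CharP K 2] : K →+ K where
  toFun x := x ^ 2 + x
  map_zero' := by simp
  map_add' x y := by rw [CharTwo.add_sq]; ring

theorem ncard_range_artinSchreier [Finite K] (hk : 0 < k) (hK : Nat.card K = 2 ^ k) :
    ((artinSchreier K).range : Set K).ncard = 2 ^ (k - 1) := by
  have h1 := (artinSchreier K).ker.card_mul_index
  have hker : ((artinSchreier K).ker : Set K) = {0, 1} := by
    ext x
    simp only [SetLike.mem_coe, AddMonoidHom.mem_ker, Set.mem_insert_iff, Set.mem_singleton_iff]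
    change x ^ 2 + x = 0 ↔ _
    rw [show x ^ 2 + x = x * (x + 1) by ring, mul_eq_zero, CharTwo.add_eq_zero]
  have h2 : Nat.card (artinSchreier K).ker = 2 := by
    rw [← SetLike.coe_sort_coe, hker, Nat.card_coe_set_eq, Set.ncard_pair zero_ne_one]
  rw [AddSubgroup.index_ker, h2, hK, ← SetLike.coe_sort_coe, Nat.card_coe_set_eq] at h1
  obtain ⟨k, rfl⟩ := Nat.exists_eq_succ_of_ne_zero hk.ne'
  rw [Nat.succ_eq_add_one, pow_succ'] at h1
  exact Nat.eq_of_mul_eq_mul_left two_pos h1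

/-- The image of `x² + x` has `2^(k-1)` elements of trace zero, and the trace polynomial has degree
too small for more roots. -/
theorem absTrace_eq_zero_eq_range [Finite K] (hk : 0 < k) (hK : Nat.card K = 2 ^ k) :
    {x : K | absTrace k x = 0} = (artinSchreier K).range := by
  symm
  refine Set.eq_of_subset_of_ncard_le ?_ ?_ (Set.toFinite _)
  · rintro _ ⟨x, rfl⟩
    change absTraceHom K k (x ^ 2 + x) = 0
    rw [map_add, absTraceHom_pow_two hK, CharTwo.add_self_eq_zero]
  · rw [ncard_range_artinSchreier hk hK]
    exact ncard_absTrace_eq_zero_le hk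

theorem ncard_absTrace_eq_one [Finite K] (hk : 0 < k) (hK : Nat.card K = 2 ^ k) :
    {x : K | absTrace k x = 1}.ncard = 2 ^ (k - 1) := by
  have h0 : {x : K | absTrace k x = 0}.ncard = 2 ^ (k - 1) := by
    rw [absTrace_eq_zero_eq_range hk hK, ncard_range_artinSchreier hk hK]
  have hc : {x : K | absTrace k x = 1} = {x : K | absTrace k x = 0}ᶜ := by
    ext x
    simp only [Set.mem_compl_iff, Set.mem_ofPred_eq]
    rcases absTraceHom_eq_zero_or_one hK x with h | h <;> rw [absTraceHom_apply] at h <;> simp [h]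
  have := Set.ncard_add_ncard_compl {x : K | absTrace k x = 0}
  rw [← hc, h0, hK] at this
  obtain ⟨k, rfl⟩ := Nat.exists_eq_succ_of_ne_zero hk.ne'
  simp only [Nat.succ_eq_add_one, pow_succ, Nat.add_sub_cancel] at this ⊢
  omega

/-- As `e(i+1) = e(i) 2^l + 1`, each new term of `H` turns `(1+x)^e(i)` into `(1+x)^e(i+1)` up to
some `c + c^(2^l)`, which has trace zero. -/
theorem absTraceHom_H [Finite K] (hK : Nat.card K = 2 ^ k) (l i : ℕ) (x : K) :
    absTraceHom K k ((H K l i).eval x) = absTraceHom K k ((1 + x) ^ e l i + 1) := by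
  have two := CharTwo.two_eq_zero (R := K)
  induction i with
  | zero => simp [H, e, CharTwo.add_self_eq_zero]
  | succ i ih =>
    have he : e l (i + 1) = e l i * 2 ^ l + 1 := by
      simp only [e, Finset.sum_range_succ', Finset.sum_mul, ← pow_add]
      simp [add_mul]
    have hH : (H K l (i + 1)).eval x = (H K l i).eval x + x * ((1 + x) ^ e l i) ^ 2 ^ l := by
      simp only [H]
      rw [Finset.sum_Icc_succ_top (by omega), he, mul_add, eval_add]
      simp [pow_mul]
    rw [hH, map_add, ih, ← map_add, he, pow_succ, pow_mul]
    have : (1 + x) ^ e l i + 1 + x * ((1 + x) ^ e l i) ^ 2 ^ l =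
        (((1 + x) ^ e l i) ^ 2 ^ l * (1 + x) + 1) +
          ((1 + x) ^ e l i + ((1 + x) ^ e l i) ^ 2 ^ l) := by
      grind
    rw [this, map_add _ _ ((1 + x) ^ e l i + _), map_add _ ((1 + x) ^ e l i),
      absTraceHom_pow_two_pow hK, CharTwo.add_self_eq_zero, add_zero]

end Trace

/-! ### Specialization to `σ x = x^(2^l)` -/

section Frobenius

variable {K : Type*} [Field K] [CharP K 2] {k l n : ℕ}

theorem iterate_iterateFrobenius (i : ℕ) (x : K) :
    (iterateFrobenius K 2 l)^[i] x = x ^ 2 ^ (i * l) := by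
  induction i with
  | zero => simp
  | succ i ih =>
    rw [Function.iterate_succ_apply', ih, iterateFrobenius_def, ← pow_mul, ← pow_add, Nat.succ_mul]

theorem iterate_iterateFrobenius_inverse [Finite K] (hK : Nat.card K = 2 ^ k)
    (hl : 0 < l * n) (h : l * n ≡ 1 [MOD k]) (x : K) :
    (iterateFrobenius K 2 l)^[n] x = x ^ 2 := by
  obtain ⟨j, hj⟩ := (Nat.modEq_iff_dvd' hl).1 h.symm
  rw [iterate_iterateFrobenius, mul_comm, show l * n = k * j + 1 by omega, pow_succ, pow_mul,
    pow_two_pow_mul_eq_self hK]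

theorem eval_P_eq_zero_iff (a x : K) :
    (P l a).eval x = 0 ↔ x * iterateFrobenius K 2 l x + x + a = 0 := by
  simp [P, iterateFrobenius_def, pow_succ']

theorem numZeros_eq (a : K) :
    numZeros l a = {x : K | x * iterateFrobenius K 2 l x + x + a = 0}.ncard := by
  simp only [numZeros, eval_P_eq_zero_iff]

omit [CharP K 2] in
theorem pow_mul_inv_pow_sub {a : K} (ha : a ≠ 0) {p q : ℕ} (h : q ≤ p) :
    a ^ p * a⁻¹ ^ (p - q) = a ^ q := by
  rw [inv_pow, pow_sub₀ _ ha h]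
  field_simp

theorem semilin_R [Finite K] {a : K} (ha : a ≠ 0) (hn0 : 0 < n)
    (hn : ∀ x, (iterateFrobenius K 2 l)^[n] x = x ^ 2) :
    semilin (iterateFrobenius K 2 l) a ((R K l n).eval a⁻¹) = 1 := by
  obtain ⟨n, rfl⟩ := Nat.exists_eq_succ_of_ne_zero hn0.ne'
  have hle : ∀ i, 2 ^ ((i + 1) * l) ≤ 2 ^ ((i + 2) * l) := fun i =>
    Nat.pow_le_pow_right two_pos (Nat.mul_le_mul_right _ (by omega))
  have hmul : ∀ p (x : K), a ^ p * (a⁻¹ ^ p * x) = x := fun p x => by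
    rw [inv_pow, mul_inv_cancel_left₀ (pow_ne_zero _ ha)]
  rw [R, eval_add, eval_finsetSum]
  apply semilin_dobbertin _ ha hn (u := fun i => (A K l i).eval a⁻¹)
    (v := fun i => (B K l i).eval a⁻¹)
  · simp [A]
  · simp [A]
  · rintro (_ | i)
    · simp only [A, iterate_iterateFrobenius]
      simp only [eval_X, eval_zero, pow_succ]
      simp [ha]
    · simp only [A, iterate_iterateFrobenius, eval_add, eval_mul, eval_pow, eval_X]
      rw [mul_add, hmul, ← mul_assoc, pow_mul_inv_pow_sub ha (hle i)]
  · simp [B]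
  · simp only [B, iterateFrobenius_def, eval_pow, eval_X]
    rw [pow_mul_inv_pow_sub ha (Nat.one_le_two_pow), pow_one]
  · intro i
    simp only [B, iterate_iterateFrobenius, eval_add, eval_mul, eval_pow, eval_X]
    rw [mul_add, hmul, ← mul_assoc, pow_mul_inv_pow_sub ha (hle i)]

/-- With `c = 1 + x⁻¹` and `s = c^(e n)`, the identity `e(n) 2^l + 1 = e(n) + 2^(n l)` and `σ^[n] c
= c²` give `σ s = c s`. -/
theorem exists_zeroOf_eq {a x : K} (ha : a ≠ 0)
    (hn : ∀ x, (iterateFrobenius K 2 l)^[n] x = x ^ 2)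
    (hx : x * iterateFrobenius K 2 l x + x + a = 0) :
    (1 + x⁻¹) ^ e l n ≠ 0 ∧
      iterateFrobenius K 2 l ((1 + x⁻¹) ^ e l n) + (1 + x⁻¹) ^ e l n ≠ 0 ∧
      zeroOf (iterateFrobenius K 2 l) ((1 + x⁻¹) ^ e l n) = x := by
  have two := CharTwo.two_eq_zero (R := K)
  have x0 : x ≠ 0 := by
    rintro rfl
    simp [ha] at hx
  have x1 : 1 + x⁻¹ ≠ 0 := by
    intro h
    rw [CharTwo.add_eq_zero, eq_comm, inv_eq_one] at h
    rw [h, map_one, mul_one, CharTwo.add_self_eq_zero, zero_add] at hx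
    exact ha hx
  have hs : (1 + x⁻¹) ^ e l n ≠ 0 := pow_ne_zero _ x1
  have key : iterateFrobenius K 2 l ((1 + x⁻¹) ^ e l n) = (1 + x⁻¹) ^ e l n * (1 + x⁻¹) := by
    have e1 : e l n * 2 ^ l + 1 = e l n + 2 ^ (n * l) := by
      rw [e, ← Finset.sum_range_succ (fun j => 2 ^ (j * l)), Finset.sum_range_succ', Finset.sum_mul]
      simp only [← pow_add]
      simp [add_mul]
    apply mul_right_cancel₀ x1
    rw [iterateFrobenius_def, ← pow_mul, ← pow_succ, e1, pow_add, ← iterate_iterateFrobenius, hn]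
    ring
  have hD : iterateFrobenius K 2 l ((1 + x⁻¹) ^ e l n) + (1 + x⁻¹) ^ e l n =
      (1 + x⁻¹) ^ e l n * x⁻¹ := by
    rw [key]; grind
  refine ⟨hs, ?_, ?_⟩
  · rw [hD]
    exact mul_ne_zero hs (inv_ne_zero x0)
  · rw [zeroOf, hD, div_mul_cancel_left₀ hs, inv_inv]

end Frobenius

/-! ### Zero counts, the trace criterion and the numbers `M_i` -/

section Main

variable {K : Type*} [Field K] [Finite K] [CharP K 2] {k l n : ℕ}

theorem numZeros_of_zero (hk : 0 < k) (hK : Nat.card K = 2 ^ k)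
    (hn : ∀ x, (iterateFrobenius K 2 l)^[n] x = x ^ 2) {a x : K} (ha : a ≠ 0)
    (hx : x * iterateFrobenius K 2 l x + x + a = 0) :
    (absTrace k ((1 + x⁻¹) ^ e l n) = 1 ∧ numZeros l a = 1) ∨
      (absTrace k ((1 + x⁻¹) ^ e l n) = 0 ∧ numZeros l a = 3) := by
  obtain ⟨hs, hD, rfl'⟩ := exists_zeroOf_eq ha hn hx
  have has := eq_coeffOf_of_zero (iterateFrobenius K 2 l) (rfl'.symm ▸ hx)
  rcases absTraceHom_eq_zero_or_one hK ((1 + x⁻¹) ^ e l n) with h | h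
  · refine Or.inr ⟨h, ?_⟩
    rw [numZeros_eq]
    apply ncard_zeros_eq_three _ hn hs hD has
    have : (1 + x⁻¹) ^ e l n ∈ {x : K | absTrace k x = 0} := h
    rw [absTrace_eq_zero_eq_range hk hK] at this
    exact this
  · refine Or.inl ⟨h, ?_⟩
    rw [numZeros_eq, zeros_eq_singleton _ (absTraceHom K k) (absTraceHom_pow_two_pow hK · l) hs hD has,
      Set.ncard_singleton]
    rw [h]
    exact one_ne_zero

theorem numZeros_eq_zero (a : K) (h : ∀ x, x * iterateFrobenius K 2 l x + x + a ≠ 0) :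
    numZeros l a = 0 := by
  rw [numZeros_eq, Set.ncard_eq_zero]
  exact Set.eq_empty_of_forall_notMem h

theorem numZeros_cases (hk : 0 < k) (hK : Nat.card K = 2 ^ k)
    (hn : ∀ x, (iterateFrobenius K 2 l)^[n] x = x ^ 2) {a : K} (ha : a ≠ 0) :
    numZeros l a = 0 ∨ numZeros l a = 1 ∨ numZeros l a = 3 := by
  by_cases h : ∃ x, x * iterateFrobenius K 2 l x + x + a = 0
  · obtain ⟨x, hx⟩ := h
    rcases numZeros_of_zero hk hK hn ha hx with h | h
    · exact Or.inr (Or.inl h.2)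
    · exact Or.inr (Or.inr h.2)
  · push Not at h
    exact Or.inl (numZeros_eq_zero a h)

theorem absTraceHom_R_of_zero (hK : Nat.card K = 2 ^ k) (hn0 : 0 < n)
    (hn : ∀ x, (iterateFrobenius K 2 l)^[n] x = x ^ 2) {a x : K} (ha : a ≠ 0)
    (hx : x * iterateFrobenius K 2 l x + x + a = 0) :
    absTraceHom K k ((R K l n).eval a⁻¹) = absTraceHom K k ((1 + x⁻¹) ^ e l n + 1) := by
  obtain ⟨hs, hD, hz⟩ := exists_zeroOf_eq ha hn hx
  have has := eq_coeffOf_of_zero (iterateFrobenius K 2 l) (hz.symm ▸ hx)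
  have hR := semilin_R ha hn0 hn
  conv at hR => lhs; arg 2; rw [has]
  rw [add_comm]
  exact trace_of_semilin _ (absTraceHom K k) (absTraceHom_pow_two_pow hK · l) hn hs hD hR

theorem numZeros_eq_one_iff (hk : 0 < k) (hK : Nat.card K = 2 ^ k) (hn0 : 0 < n)
    (hn : ∀ x, (iterateFrobenius K 2 l)^[n] x = x ^ 2) {a : K} (ha : a ≠ 0) :
    numZeros l a = 1 ↔ absTrace k ((R K l n).eval a⁻¹ + 1) = 1 := by
  rw [← absTraceHom_apply, map_add]
  by_cases h : ∃ x, x * iterateFrobenius K 2 l x + x + a = 0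
  · obtain ⟨x, hx⟩ := h
    rw [absTraceHom_R_of_zero hK hn0 hn ha hx, map_add, add_assoc, CharTwo.add_self_eq_zero,
      add_zero, absTraceHom_apply]
    rcases numZeros_of_zero hk hK hn ha hx with h | h <;> simp [h]
  · push Not at h
    rw [numZeros_eq_zero a h, trace_of_semilin_of_no_zero _ (absTraceHom K k)
      (absTraceHom_pow_two_pow hK · l) (absTraceHom_eq_zero_or_one hK) hn (semilin_R ha hn0 hn) h,
      CharTwo.add_self_eq_zero]
    simp

/-- `coeffOf` is a bijection from this set onto the `a` with one zero; `s = 1` is excluded because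
then `σ s + s = 0`. -/
theorem M_one_eq (hk : 0 < k) (hK : Nat.card K = 2 ^ k)
    (hn : ∀ x, (iterateFrobenius K 2 l)^[n] x = x ^ 2) :
    M K l 1 = {s : K | absTrace k s = 1 ∧ s ≠ 1}.ncard := by
  have hT : ∀ x, absTraceHom K k (iterateFrobenius K 2 l x) = absTraceHom K k x :=
    (absTraceHom_pow_two_pow hK · l)
  have hmem : ∀ s : K, absTrace k s = 1 ∧ s ≠ 1 →
      s ≠ 0 ∧ iterateFrobenius K 2 l s + s ≠ 0 ∧ absTraceHom K k s ≠ 0 := by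
    rintro s ⟨h1, h2⟩
    rw [← absTraceHom_apply] at h1
    have h0 : s ≠ 0 := by
      rintro rfl
      simp at h1
    exact ⟨h0, map_add_self_ne_zero _ hn h0 h2, by rw [h1]; exact one_ne_zero⟩
  have hinj : Set.InjOn (coeffOf (iterateFrobenius K 2 l)) {s : K | absTrace k s = 1 ∧ s ≠ 1} := by
    intro s hs t ht hst
    obtain ⟨s0, sD, sT⟩ := hmem s hs
    obtain ⟨t0, tD, tT⟩ := hmem t ht
    apply zeroOf_injective _ hn s0 t0 sD tD
    have z1 := zeros_eq_singleton _ _ hT s0 sD rfl sT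
    have z2 := zeros_eq_singleton _ _ hT t0 tD rfl tT
    rw [hst, z2] at z1
    exact (Set.singleton_injective z1).symm
  rw [M, ← hinj.ncard_image]
  congr 1
  ext a
  simp only [Set.mem_image, Set.mem_ofPred_eq]
  constructor
  · rintro ⟨ha, h1⟩
    by_cases h : ∃ x, x * iterateFrobenius K 2 l x + x + a = 0
    · obtain ⟨x, hx⟩ := h
      obtain ⟨hs, hD, hz⟩ := exists_zeroOf_eq ha hn hx
      have has := eq_coeffOf_of_zero (iterateFrobenius K 2 l) (hz.symm ▸ hx)
      refine ⟨_, ⟨?_, ?_⟩, has.symm⟩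
      · rcases numZeros_of_zero hk hK hn ha hx with h | h
        · exact h.1
        · omega
      · intro h
        apply hD
        rw [h, map_one, CharTwo.add_self_eq_zero]
    · push Not at h
      rw [numZeros_eq_zero a h] at h1
      omega
  · rintro ⟨s, hs, rfl⟩
    obtain ⟨s0, sD, sT⟩ := hmem s hs
    refine ⟨coeffOf_ne_zero _ s0 sD, ?_⟩
    rw [numZeros_eq, zeros_eq_singleton _ _ hT s0 sD rfl sT, Set.ncard_singleton]

theorem M_one_of_odd (hk : Odd k) (hK : Nat.card K = 2 ^ k)
    (hn : ∀ x, (iterateFrobenius K 2 l)^[n] x = x ^ 2) : M K l 1 + 1 = 2 ^ (k - 1) := by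
  have h1 : absTrace k (1 : K) = 1 := by
    rw [← absTraceHom_apply, absTraceHom_one, CharTwo.natCast_eq_ite, if_neg (Nat.not_even_iff_odd.2 hk)]
  rw [M_one_eq hk.pos hK hn, ← ncard_absTrace_eq_one hk.pos hK]
  exact Set.ncard_sdiff_singleton_add_one (s := {s : K | absTrace k s = 1}) h1

theorem M_one_of_even (hk0 : 0 < k) (hk : Even k) (hK : Nat.card K = 2 ^ k)
    (hn : ∀ x, (iterateFrobenius K 2 l)^[n] x = x ^ 2) : M K l 1 = 2 ^ (k - 1) := by
  have h1 : absTrace k (1 : K) ≠ 1 := by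
    rw [← absTraceHom_apply, absTraceHom_one, CharTwo.natCast_eq_ite, if_pos hk]
    exact zero_ne_one
  rw [M_one_eq hk0 hK hn, ← ncard_absTrace_eq_one hk0 hK]
  congr 1
  ext s
  simp only [Set.mem_ofPred_eq, and_iff_left_iff_imp]
  rintro h rfl
  exact h1 h

theorem M_sums (hk : 0 < k) (hK : Nat.card K = 2 ^ k)
    (hn : ∀ x, (iterateFrobenius K 2 l)^[n] x = x ^ 2) :
    M K l 0 + M K l 1 + M K l 3 + 1 = 2 ^ k ∧ M K l 1 + 3 * M K l 3 + 2 = 2 ^ k := by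
  classical
  have : Fintype K := Fintype.ofFinite K
  have hM : ∀ i, M K l i = ∑ a ∈ Finset.univ.erase (0 : K), if numZeros l a = i then 1 else 0 := by
    intro i
    rw [Finset.sum_boole, M, Nat.cast_id, ← Set.ncard_coe_finset]
    congr 1
    ext a
    simp
  have hcard : (Finset.univ : Finset K).card = 2 ^ k := by
    rw [Finset.card_univ, ← Nat.card_eq_fintype_card, hK]
  constructor
  · rw [← hcard, ← Finset.card_erase_add_one (Finset.mem_univ (0 : K)), Finset.card_eq_sum_ones,
      hM, hM, hM, ← Finset.sum_add_distrib, ← Finset.sum_add_distrib]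
    congr 1
    refine Finset.sum_congr rfl fun a ha => ?_
    rcases numZeros_cases hk hK hn (Finset.ne_of_mem_erase ha) with h | h | h <;> simp [h]
  -- Both `0` and `1` are zeros only for `a = 0`; the other `2^k - 2` elements are sorted by the
  -- value of `x σ(x) + x`.
  · have h1 : (1 : K) ∈ Finset.univ.erase (0 : K) := by simp
    rw [← hcard, ← Finset.card_erase_add_one (Finset.mem_univ (0 : K)),
      ← Finset.card_erase_add_one h1, Finset.card_eq_sum_card_fiberwise
        (f := fun x => x * iterateFrobenius K 2 l x + x) (t := Finset.univ.erase (0 : K)),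
      hM, hM, Finset.mul_sum, ← Finset.sum_add_distrib]
    · rw [add_assoc _ 1 1]
      congr 1
      refine Finset.sum_congr rfl fun a ha => ?_
      have ha0 := Finset.ne_of_mem_erase ha
      have hf : (((Finset.univ.erase (0 : K)).erase 1).filter
          fun x => x * iterateFrobenius K 2 l x + x = a).card = numZeros l a := by
        rw [numZeros_eq, ← Set.ncard_coe_finset]
        congr 1
        ext x
        simp only [Finset.coe_filter, Finset.mem_erase, Finset.mem_univ, and_true,
          Set.mem_ofPred_eq, CharTwo.add_eq_zero (b := a), and_iff_right_iff_imp]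
        rintro rfl
        refine ⟨?_, ?_⟩ <;> rintro rfl <;> simp [CharTwo.add_self_eq_zero] at ha0
      rw [hf]
      rcases numZeros_cases hk hK hn ha0 with h | h | h <;> simp [h]
    · intro x hx
      simp only [Finset.coe_erase, Finset.coe_univ, Set.mem_sdiff, Set.mem_univ, true_and,
        Set.mem_singleton_iff] at hx ⊢
      rw [show x * iterateFrobenius K 2 l x + x = x * (iterateFrobenius K 2 l x + 1) by ring,
        mul_eq_zero, CharTwo.add_eq_zero, map_eq_one_iff _ (RingHom.injective _)]
      tauto

end Main

end TrinomialGF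

theorem theorem1 {K : Type*} [Field K] [Finite K] (k l l' : ℕ)
    (hK : Nat.card K = 2 ^ k)
    (hl : 0 < l) (hlk : l < k) (hgcd : Nat.gcd l k = 1)
    -- `l'` is the inverse of `l` modulo `k`
    (hl'k : l' < k) (hl' : l * l' ≡ 1 [MOD k]) :
    (∀ a : K, a ≠ 0 →
      (TrinomialGF.numZeros l a = 0 ∨ TrinomialGF.numZeros l a = 1 ∨
        TrinomialGF.numZeros l a = 3) ∧
      (TrinomialGF.numZeros l a = 1 ↔
        TrinomialGF.absTrace k ((TrinomialGF.R K l l').eval a⁻¹ + 1) = 1) ∧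
      (∀ x₀ : K, (TrinomialGF.P l a).eval x₀ = 0 →
        TrinomialGF.absTrace k ((TrinomialGF.R K l l').eval a⁻¹) =
            TrinomialGF.absTrace k ((TrinomialGF.H K l l').eval x₀⁻¹) ∧
        TrinomialGF.absTrace k ((TrinomialGF.H K l l').eval x₀⁻¹) =
            TrinomialGF.absTrace k ((1 + x₀⁻¹) ^ TrinomialGF.e l l' + 1))) ∧
    (Odd k →
      (TrinomialGF.M K l 0 : ℚ) = (2 ^ k + 1) / 3 ∧
      (TrinomialGF.M K l 1 : ℚ) = 2 ^ (k - 1) - 1 ∧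
      (TrinomialGF.M K l 3 : ℚ) = (2 ^ (k - 1) - 1) / 3) ∧
    (Even k →
      (TrinomialGF.M K l 0 : ℚ) = (2 ^ k - 1) / 3 ∧
      (TrinomialGF.M K l 1 : ℚ) = 2 ^ (k - 1) ∧
      (TrinomialGF.M K l 3 : ℚ) = (2 ^ (k - 1) - 2) / 3) := by
  open TrinomialGF in
  have hk : 0 < k := by omega
  have := charP_two_of_card hK
  have hl'0 : 0 < l' := by
    rcases Nat.eq_zero_or_pos l' with rfl | h
    · rw [mul_zero, Nat.ModEq, Nat.zero_mod, Nat.mod_eq_of_lt (by omega)] at hl'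
      omega
    · exact h
  have hn := iterate_iterateFrobenius_inverse hK (Nat.mul_pos hl hl'0) hl'
  obtain ⟨hsum, hsum3⟩ := M_sums hk hK hn
  have hpow : 2 ^ k = 2 * 2 ^ (k - 1) := by rw [← pow_succ', Nat.sub_add_cancel hk]
  have hpowQ : (2 : ℚ) ^ k = 2 * 2 ^ (k - 1) := by exact_mod_cast hpow
  have hsumQ : (M K l 0 + M K l 1 + M K l 3 + 1 : ℚ) = 2 ^ k := by exact_mod_cast hsum
  have hsum3Q : (M K l 1 + 3 * M K l 3 + 2 : ℚ) = 2 ^ k := by exact_mod_cast hsum3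
  refine ⟨fun a ha => ⟨numZeros_cases hk hK hn ha, numZeros_eq_one_iff hk hK hl'0 hn ha,
    fun x₀ hx => ?_⟩, fun hodd => ?_, fun heven => ?_⟩
  · have hH := absTraceHom_H hK l l' x₀⁻¹
    exact ⟨(absTraceHom_R_of_zero hK hl'0 hn ha ((eval_P_eq_zero_iff a x₀).1 hx)).trans hH.symm, hH⟩
  · have h1 : (M K l 1 + 1 : ℚ) = 2 ^ (k - 1) := by exact_mod_cast M_one_of_odd hodd hK hn
    refine ⟨?_, ?_, ?_⟩ <;> linarith
  · have h1 : (M K l 1 : ℚ) = 2 ^ (k - 1) := by exact_mod_cast M_one_of_even hk heven hK hn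
    refine ⟨?_, ?_, ?_⟩ <;> linarith
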